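/- Algebras are non-empty, and of an arbitrary fixed finitary signature. Let $\mathbf M$ be a finite algebra with universe $M$, and let $\mathcal A=\mathbb{ISP}(\mathbf M)$ be the quasivariety generated by $\mathbf M$, i.e. the class of all algebras isomorphic to a subalgebra of a power of $\mathbf M$. Let $\underset{\sim}{\mathbf M}=(M;G,R,\mathscr T)$ be a total alter ego of $\mathbf M$: $\mathscr T$ is the discrete topology, $G$ is a family of (total) finitary operations $M^n\to M$ that are homomorphisms $\mathbf M^n\to\mathbf M$, and $R$ is a family of finitary relations $r\subseteq M^n$ that are (possibly empty) subalgebras of $\mathbf M^n$; there are no partial operations. Let $\mathcal X=\mathbb{IS}_c\mathbb P^+(\underset{\sim}{\mathbf M})$ be the class of topological structures isomorphic to a topologically closed, possibly empty, substructure of a power of $\underset{\sim}{\mathbf M}$ with non-empty index set; its morphisms are the continuous maps preserving all operations and relations. For $\mathbf A\in\mathcal A$ let $D(\mathbf A)=\mathcal A(\mathbf A,\mathbf M)$, as a closed substructure of $\underset{\sim}{\mathbf M}^{A}$; for $\mathbf X\in\mathcal X$ let $E(\mathbf X)=\mathcal X(\mathbf X,\underset{\sim}{\mathbf M})$, as a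 subalgebra of $\mathbf M^{X}$; and let $e_{\mathbf A}\colon\mathbf A\to ED(\mathbf A)$ be the evaluation map $e_{\mathbf A}(a)(x)=x(a)$. Suppose that $\underset{\sim}{\mathbf M}$ yields a strong duality on $\mathcal A$, that is: 1. (duality) $e_{\mathbf A}$ is an isomorphism for every $\mathbf A\in\mathcal A$; 2. (fullness) $DE(\mathbf X)\cong\mathbf X$ for every $\mathbf X\in\mathcal X$; 3. (injectivity) $\underset{\sim}{\mathbf M}$ is injective in $\mathcal X$: for every $\mathbf X\in\mathcal X$ and every closed substructure $\mathbf Y$ of $\mathbf X$, each morphism $\mathbf Y\to\underset{\sim}{\mathbf M}$ extends to a morphism $\mathbf X\to\underset{\sim}{\mathbf M}$. Then $\mathcal A$ has the amalgamation property: for all $\mathbf A,\mathbf B,\mathbf C\in\mathcal A$ and all embeddings $f_B\colon\mathbf A\to\mathbf B$ and $f_C\colon\mathbf A\to\mathbf C$ there are an algebra $\mathbf D\in\mathcal A$ and embeddings $h_B\colon\mathbf B\to\mathbf D$ and $h_C\colon\mathbf C\to\mathbf D$ with $h_B\circ f_B=h_C\circ f_C$. -/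

import Mathlib

open FirstOrder FirstOrder.Language CategoryTheory

universe u u₁ v₁ u₂ v₂

namespace NaturalDuality

/-- The power `N ^ S` of a structure, with operations and relations defined pointwise. -/
instance powerStructure (K : FirstOrder.Language.{u₁, v₁}) (N : Type*) [K.Structure N] (S : Type*) :
    K.Structure (S → N) where
  funMap f x := fun s => Structure.funMap f (fun i => x i s)
  RelMap r x := ∀ s, Structure.RelMap r (fun i => x i s)

/-- The class `ISP(M)` of (non-empty) algebras isomorphic to a subalgebra of a power of `M`.
The power indexed by the empty set is allowed. -/
def ISP (L : FirstOrder.Language.{u₁, v₁}) (M : Type u) [L.Structure M] :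
    Set (Bundled.{u} L.Structure) :=
  {A | Nonempty A ∧ ∃ (I : Type u) (B : L.Substructure (I → M)), Nonempty (A ≃[L] B)}

/-- Two topological structures are isomorphic: there is an isomorphism of structures between them
which is a homeomorphism. -/
def TopIsomorphic (L' : FirstOrder.Language.{u₂, v₂}) (X Y : Type*) [TopologicalSpace X] [L'.Structure X]
    [TopologicalSpace Y] [L'.Structure Y] : Prop :=
  ∃ e : X ≃[L'] Y, IsHomeomorph e

/-- The class of topological structures isomorphic to a topologically closed (possibly empty)
substructure of a power of `M` with non-empty index set, in the product topology. -/
def InIScP (L' : FirstOrder.Language.{u₂, v₂}) (M : Type u) [L'.Structure M] [TopologicalSpace M]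
    (X : Type u) [TopologicalSpace X] [L'.Structure X] : Prop :=
  ∃ (S : Type u) (Y : L'.Substructure (S → M)),
    Nonempty S ∧ IsClosed (Y : Set (S → M)) ∧ TopIsomorphic L' X Y

/-- The total structure given by the `L'`-operations and `L'`-relations on `M` is algebraic over
the algebra given by the `L`-operations on `M`: every `n`-ary `L'`-operation is a homomorphism
`M ^ n → M` of `L`-algebras (equivalently, its graph is a subalgebra of `M ^ (n + 1)`), and every
`n`-ary `L'`-relation is a subalgebra of `M ^ n`. With the discrete topology on `M`, this says that
the total structure is an alter ego of the algebra. There are no partial operations. -/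
structure TotalAlterEgo (L : FirstOrder.Language.{u₁, v₁}) (L' : FirstOrder.Language.{u₂, v₂}) (M : Type u)
    [L.Structure M] [L'.Structure M] : Prop where
  comm : ∀ {n k : ℕ} (g : L'.Functions n) (f : L.Functions k) (x : Fin k → Fin n → M),
    Structure.funMap g (fun j => Structure.funMap f (fun i => x i j)) =
      Structure.funMap f (fun i => Structure.funMap g (x i))
  rel : ∀ {n k : ℕ} (r : L'.Relations n) (f : L.Functions k) (x : Fin k → Fin n → M),
    (∀ i, Structure.RelMap r (x i)) →
      Structure.RelMap r (fun j => Structure.funMap f (fun i => x i j))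

namespace TotalAlterEgo

variable {L : FirstOrder.Language.{u₁, v₁}} [L.IsAlgebraic] {L' : FirstOrder.Language.{u₂, v₂}} {M : Type u}
  [L.Structure M] [L'.Structure M]

/-- The dual `D(A)` of an algebra `A`: the set of homomorphisms `A → M`, as a substructure of the
power `M ^ A` of the alter ego (its topology is the subspace topology). -/
def D (h : TotalAlterEgo L L' M) (A : Type*) [L.Structure A] : L'.Substructure (A → M) where
  carrier := {x | ∃ φ : A →[L] M, ⇑φ = x}
  fun_mem := by
    intro n g x hx
    choose φ hφ using hx
    refine ⟨⟨fun a => Structure.funMap g (fun j => φ j a), ?_, fun r => isEmptyElim r⟩, ?_⟩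
    · intro k f a
      have := h.comm g f (fun i j => φ j (a i))
      simpa [Function.comp_def] using this
    · funext a
      simp [← hφ, Structure.funMap]
      rfl

variable [TopologicalSpace M] [DiscreteTopology M]

/-- The algebra `E(X)` of a topological structure `X`: the set of morphisms (continuous maps
preserving operations and relations) from `X` to the alter ego, as a subalgebra of `M ^ X`. -/
def E (h : TotalAlterEgo L L' M) (X : Type*) [TopologicalSpace X] [L'.Structure X] :
    L.Substructure (X → M) where
  carrier := {α | ∃ φ : X →[L'] M, Continuous φ ∧ ⇑φ = α}
  fun_mem := by
    intro k f α hα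
    choose φ hc hφ using hα
    refine ⟨⟨fun x => Structure.funMap f (fun i => φ i x), ?_, ?_⟩, ?_, ?_⟩
    · intro n g x
      have := h.comm g f (fun i j => φ i (x j))
      simpa [Function.comp_def] using this.symm
    · intro n r x hx
      exact h.rel r f (fun i j => φ i (x j)) (fun i => (φ i).map_rel r x hx)
    · exact (continuous_of_discreteTopology (f := fun y : Fin k → M => Structure.funMap f y)).comp
        (continuous_pi hc)
    · funext x
      simp [← hφ, Structure.funMap]
      rfl

/-- The evaluation homomorphism `e_A : A → E(D(A))`, `e_A(a)(x) = x(a)`. -/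
def e (h : TotalAlterEgo L L' M) (A : Type*) [L.Structure A] : A →[L] h.E (h.D A) where
  toFun a := ⟨fun x => x.1 a,
    ⟨⟨fun x => x.1 a, fun _ _ => rfl, fun _ _ hx => hx a⟩,
      (continuous_apply a).comp continuous_subtype_val, rfl⟩⟩
  map_fun' := by
    intro n f a
    apply Subtype.ext
    funext x
    obtain ⟨x, φ, rfl⟩ := x
    exact φ.map_fun f a
  map_rel' := fun r => isEmptyElim r

/-- The alter ego yields a duality on `ISP(M)`: each `e_A` is an isomorphism (for algebras, this
means a bijective homomorphism). -/
def YieldsDuality (h : TotalAlterEgo L L' M) : Prop :=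
  ∀ A ∈ ISP L M, Function.Bijective (h.e A)

/-- The alter ego yields a full duality on `ISP(M)`: it yields a duality, and `D(E(X))` is
isomorphic to `X` for each `X` in the topological quasivariety generated by the alter ego. -/
def YieldsFullDuality (h : TotalAlterEgo L L' M) : Prop :=
  h.YieldsDuality ∧
    ∀ (X : Type u) [TopologicalSpace X] [L'.Structure X], InIScP L' M X →
      TopIsomorphic L' (h.D (h.E X)) X

variable (L' M) in
/-- The topological structure `M` is injective in the topological quasivariety it generates:
morphisms into `M` extend along embeddings, that is, from closed substructures. -/
def IsInjective : Prop :=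
  ∀ (X : Type u) [TopologicalSpace X] [L'.Structure X], InIScP L' M X →
    ∀ Y : L'.Substructure X, IsClosed (Y : Set X) →
      ∀ α : Y →[L'] M, Continuous α →
        ∃ β : X →[L'] M, Continuous β ∧ ∀ y : Y, β y = α y

/-- The alter ego yields a strong duality on `ISP(M)`: it yields a full duality, and it is
injective in the topological quasivariety it generates. -/
def YieldsStrongDuality (h : TotalAlterEgo L L' M) : Prop :=
  h.YieldsFullDuality ∧ IsInjective L' M

end TotalAlterEgo

end NaturalDuality

/-!
Fix an embedding `f : A → B` in `ISP(M)`. The restrictions `ψ ∘ f` of homomorphisms `ψ : B → M`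
form a closed substructure `Y` of `D(A)`, by compactness, and `Y` separates the points of `A`.
Injectivity and duality make every morphism `Y → M` the evaluation at a unique element of `A`, so
`A ≅ E(Y)`. By fullness each homomorphism `E(Y) → M` is the evaluation at a point of `Y`, whence
`Y = D(A)`: every homomorphism `A → M` extends along `f`. Given embeddings `A → B` and `A → C`, it
follows that the compatible pairs of homomorphisms `B → M` and `C → M` project onto all
homomorphisms on either side, so `B` and `C` both embed in the power of `M` indexed by these pairs.
-/

namespace NaturalDuality

section Power

variable {K : FirstOrder.Language.{u₁, v₁}} {N : Type*} [K.Structure N] {S T : Type*}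

/-- The projection of the power `N ^ S` to the coordinate `s`. -/
def powerEval (s : S) : (S → N) →[K] N where
  toFun x := x s
  map_fun' _ _ := rfl
  map_rel' _ _ hx := hx s

/-- The homomorphism into the power `N ^ S` with prescribed coordinates. -/
def powerLift {A : Type*} [K.Structure A] (φ : S → A →[K] N) : A →[K] (S → N) where
  toFun a s := φ s a
  map_fun' f a := funext fun s => (φ s).map_fun f a
  map_rel' r a ha s := (φ s).map_rel r a ha

/-- Reindexing `x ↦ x ∘ f` along a map of index sets, as a homomorphism `N ^ T → N ^ S`. -/
def powerPrecomp (f : S → T) : (T → N) →[K] (S → N) :=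
  powerLift fun s => powerEval (f s)

end Power

section ISP

variable {L : FirstOrder.Language.{u₁, v₁}} {M : Type u} [L.Structure M]

theorem eq_of_forall_hom_eq {A : Bundled.{u} L.Structure} (hA : A ∈ ISP L M) {a b : A}
    (hab : ∀ φ : A →[L] M, φ a = φ b) : a = b := by
  obtain ⟨-, I, B, ⟨k⟩⟩ := hA
  refine k.injective (Subtype.ext (funext fun i => ?_))
  exact hab ((powerEval i).comp (B.subtype.toHom.comp k.toHom))

theorem powerLift_injective_of_surjective {A : Bundled.{u} L.Structure} (hA : A ∈ ISP L M)
    {I : Type*} {φ : I → A →[L] M} (hφ : Function.Surjective φ) :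
    Function.Injective (powerLift φ) := by
  refine fun a b hab => eq_of_forall_hom_eq hA fun ψ => ?_
  obtain ⟨i, rfl⟩ := hφ ψ
  exact congrFun hab i

theorem power_mem_ISP (I : Type u) [Nonempty (I → M)] :
    Bundled.of (c := L.Structure) (I → M) ∈ ISP L M :=
  ⟨‹_›, I, ⊤, ⟨(Substructure.topEquiv (L := L)).symm⟩⟩

/-- The structure `M` is injective in the class `𝒦`, with respect to embeddings: homomorphisms into
`M` extend along embeddings between members of `𝒦`. -/
def InjectiveIn (𝒦 : Set (Bundled.{u} L.Structure)) (M : Type u) [L.Structure M] : Prop :=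
  ∀ ⦃A B : Bundled.{u} L.Structure⦄, A ∈ 𝒦 → B ∈ 𝒦 → ∀ (f : A ↪[L] B) (φ : A →[L] M),
    ∃ ψ : B →[L] M, ψ.comp f.toHom = φ

theorem InjectiveIn.amalgamation [L.IsAlgebraic] (hM : InjectiveIn (ISP L M) M) :
    Amalgamation (ISP L M) := by
  intro A B C f g hA hB hC
  let I : Type u := {p : (B →[L] M) × (C →[L] M) // p.1.comp f.toHom = p.2.comp g.toHom}
  have fst_surjective : Function.Surjective fun p : I => p.1.1 := fun ψ => by
    obtain ⟨χ, hχ⟩ := hM hA hC g (ψ.comp f.toHom)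
    exact ⟨⟨(ψ, χ), hχ.symm⟩, rfl⟩
  have snd_surjective : Function.Surjective fun p : I => p.1.2 := fun χ => by
    obtain ⟨ψ, hψ⟩ := hM hA hB f (χ.comp g.toHom)
    exact ⟨⟨(ψ, χ), hψ⟩, rfl⟩
  let toPowerB : B ↪[L] (I → M) :=
    Embedding.ofInjective (powerLift_injective_of_surjective hB fst_surjective)
  let toPowerC : C ↪[L] (I → M) :=
    Embedding.ofInjective (powerLift_injective_of_surjective hC snd_surjective)
  have : Nonempty (I → M) := hB.1.map toPowerB
  refine ⟨.of (I → M), toPowerB, toPowerC, power_mem_ISP I, ?_⟩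
  ext a : 1
  exact funext fun p : I => DFunLike.congr_fun p.2 a

end ISP

section InIScP

variable {L' : FirstOrder.Language.{u₂, v₂}} {M : Type u} [L'.Structure M] [TopologicalSpace M]
  {S : Type u} [Nonempty S]

theorem inIScP_of_isClosed (Y : L'.Substructure (S → M)) (hY : IsClosed (Y : Set (S → M))) :
    InIScP L' M Y :=
  ⟨S, Y, ‹_›, hY, FirstOrder.Language.Equiv.refl L' Y, (Homeomorph.refl Y).isHomeomorph⟩

theorem inIScP_power : InIScP L' M (S → M) :=
  ⟨S, ⊤, ‹_›, isClosed_univ, Substructure.topEquiv.symm,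
    (Homeomorph.Set.univ (S → M)).symm.isHomeomorph⟩

end InIScP

namespace TotalAlterEgo

variable {L : FirstOrder.Language.{u₁, v₁}} {L' : FirstOrder.Language.{u₂, v₂}} {M : Type u}
  [L.Structure M] [L'.Structure M]

section Dual

variable [L.IsAlgebraic] (h : TotalAlterEgo L L' M) {A B : Type*} [L.Structure A] [L.Structure B]

theorem mem_D_iff {x : A → M} : x ∈ h.D A ↔
    ∀ (n : ℕ) (f : L.Functions n) (a : Fin n → A),
      x (Structure.funMap f a) = Structure.funMap f (x ∘ a) :=
  ⟨fun ⟨φ, hφ⟩ _ f a => hφ ▸ φ.map_fun f a,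
    fun hx => ⟨⟨x, fun {n} => hx n, fun r => isEmptyElim r⟩, rfl⟩⟩

theorem isClosed_D [TopologicalSpace M] [DiscreteTopology M] (A : Type*) [L.Structure A] :
    IsClosed (h.D A : Set (A → M)) := by
  have hD : (h.D A : Set (A → M)) = ⋂ (n : ℕ) (f : L.Functions n) (a : Fin n → A),
      {x | x (Structure.funMap f a) = Structure.funMap f (x ∘ a)} := by
    ext x
    simpa only [SetLike.mem_coe, Set.mem_iInter, Set.mem_ofPred_eq] using h.mem_D_iff
  rw [hD]
  refine isClosed_iInter fun n => isClosed_iInter fun f => isClosed_iInter fun a => ?_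
  have hf : Continuous fun y : Fin n → M => Structure.funMap f y := continuous_of_discreteTopology
  exact isClosed_eq (continuous_apply _) (hf.comp (continuous_pi fun i => continuous_apply (a i)))

/-- The image of the map `D(f) : D(B) → D(A)`, `ψ ↦ ψ ∘ f`, dual to a homomorphism `f : A → B`, as
a substructure of `M ^ A`. -/
def rangeD (f : A →[L] B) : L'.Substructure (A → M) :=
  (h.D B).map (powerPrecomp f)

theorem mem_rangeD_iff {f : A →[L] B} {x : A → M} :
    x ∈ h.rangeD f ↔ ∃ ψ : B →[L] M, ⇑(ψ.comp f) = x :=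
  ⟨fun ⟨_, ⟨ψ, hψ⟩, hx⟩ => ⟨ψ, hx ▸ hψ ▸ rfl⟩, fun ⟨ψ, hψ⟩ => ⟨ψ, ⟨ψ, rfl⟩, hψ⟩⟩

theorem rangeD_le_D (f : A →[L] B) : h.rangeD f ≤ h.D A := fun _ hx => by
  obtain ⟨ψ, hψ⟩ := h.mem_rangeD_iff.1 hx
  exact ⟨ψ.comp f, hψ⟩

theorem isClosed_rangeD [Finite M] [TopologicalSpace M] [DiscreteTopology M] (f : A →[L] B) :
    IsClosed (h.rangeD f : Set (A → M)) :=
  ((h.isClosed_D B).isCompact.image (continuous_pi fun a => continuous_apply (f a))).isClosed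

end Dual

variable [TopologicalSpace M] [DiscreteTopology M]

section Evaluation

variable (h : TotalAlterEgo L L' M)

theorem E_mem_ISP {X : Type u} [TopologicalSpace X] [L'.Structure X] (hX : InIScP L' M X) :
    Bundled.of (c := L.Structure) (h.E X) ∈ ISP L M := by
  obtain ⟨S, Y, ⟨s⟩, -, k, hk⟩ := hX
  have hcont : Continuous fun x => (k x).1 s :=
    (continuous_apply s).comp (continuous_subtype_val.comp hk.continuous)
  exact ⟨⟨_, (powerEval s).comp (Y.subtype.toHom.comp k.toHom), hcont, rfl⟩, X, h.E X, ⟨.refl L _⟩⟩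

/-- The evaluation map `X → D(E(X))` is surjective: every homomorphism from `E(X)` to `M` is the
evaluation at a point of `X`. -/
def EvaluationSurjective (X : Type*) [TopologicalSpace X] [L'.Structure X] : Prop :=
  ∀ ψ : h.E X →[L] M, ∃ x : X, ∀ α : h.E X, ψ α = α.1 x

variable [L.IsAlgebraic] {X Y : Type*} [TopologicalSpace X] [L'.Structure X] [TopologicalSpace Y]
  [L'.Structure Y]

/-- The map `E(k) : E(Y) → E(X)`, `α ↦ α ∘ k`, dual to a morphism `k : X → Y`. -/
def mapE (k : X →[L'] Y) (hk : Continuous k) : h.E Y →[L] h.E X where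
  toFun α := ⟨α.1 ∘ k, by
    obtain ⟨_, φ, hφ, rfl⟩ := α
    exact ⟨φ.comp k, hφ.comp hk, rfl⟩⟩
  map_fun' _ _ := rfl
  map_rel' r := isEmptyElim r

variable {h} in
theorem EvaluationSurjective.of_retract (hX : h.EvaluationSurjective X) {k : X →[L'] Y}
    (hk : Continuous k) {j : Y →[L'] X} (hj : Continuous j) (hkj : Function.LeftInverse k j) :
    h.EvaluationSurjective Y := by
  intro ψ
  obtain ⟨x, hx⟩ := hX (ψ.comp (h.mapE j hj))
  refine ⟨k x, fun α => ?_⟩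
  have hα : h.mapE j hj (h.mapE k hk α) = α :=
    Subtype.ext (funext fun y => congrArg α.1 (hkj y))
  calc ψ α = ψ (h.mapE j hj (h.mapE k hk α)) := by rw [hα]
    _ = α.1 (k x) := hx (h.mapE k hk α)

variable {A : Type*} [L.Structure A]

theorem evaluationSurjective_D (hA : Function.Surjective (h.e A)) :
    h.EvaluationSurjective (h.D A) := by
  intro ψ
  refine ⟨⟨ψ.comp (h.e A), ψ.comp (h.e A), rfl⟩, fun α => ?_⟩
  obtain ⟨a, rfl⟩ := hA α
  rfl

/-- The evaluation homomorphism `A → E(Y)`, `a ↦ (y ↦ y(a))`, on a substructure `Y` of `D(A)`. -/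
def evalOn {Y : L'.Substructure (A → M)} (hY : Y ≤ h.D A) : A →[L] h.E Y :=
  (h.mapE (Substructure.inclusion hY).toHom (continuous_inclusion hY)).comp (h.e A)

end Evaluation

variable [L.IsAlgebraic] {h : TotalAlterEgo L L' M}

theorem YieldsFullDuality.evaluationSurjective (hs : h.YieldsFullDuality) {X : Type u}
    [TopologicalSpace X] [L'.Structure X] (hX : InIScP L' M X) : h.EvaluationSurjective X := by
  obtain ⟨k, hk⟩ := hs.2 X hX
  have hDE : h.EvaluationSurjective (h.D (h.E X)) :=
    h.evaluationSurjective_D (hs.1 _ (h.E_mem_ISP hX)).2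
  have hk_symm : Continuous k.symm := k.toEquiv.continuous_symm_iff.2 hk.isOpenMap
  exact hDE.of_retract (k := k.toHom) hk.continuous (j := k.symm.toHom) hk_symm k.apply_symm_apply

theorem IsInjective.evalOn_surjective (hM : IsInjective L' M) {A : Type u} [Nonempty A]
    [L.Structure A] (hA : Function.Surjective (h.e A)) {Y : L'.Substructure (A → M)}
    (hYc : IsClosed (Y : Set (A → M))) (hYD : Y ≤ h.D A) :
    Function.Surjective (h.evalOn hYD) := by
  rintro ⟨_, γ, hγ, rfl⟩
  obtain ⟨β, hβ, hβγ⟩ := hM (A → M) inIScP_power Y hYc γ hγ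
  obtain ⟨a, ha⟩ := hA (h.mapE (h.D A).subtype.toHom continuous_subtype_val ⟨β, β, hβ, rfl⟩)
  refine ⟨a, Subtype.ext (funext fun y => ?_)⟩
  calc y.1 a = β y := congrFun (congrArg Subtype.val ha) (Substructure.inclusion hYD y)
    _ = γ y := hβγ y

namespace YieldsStrongDuality

theorem eq_D_of_separates (hs : h.YieldsStrongDuality) {A : Bundled.{u} L.Structure}
    (hA : A ∈ ISP L M) {Y : L'.Substructure (A → M)} (hYc : IsClosed (Y : Set (A → M)))
    (hYD : Y ≤ h.D A) (hsep : ∀ a b : A, (∀ y ∈ Y, y a = y b) → a = b) : Y = h.D A := by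
  have : Nonempty A := hA.1
  have hinj : Function.Injective (h.evalOn hYD) := fun a b hab =>
    hsep a b fun y hy => congrFun (congrArg Subtype.val hab) ⟨y, hy⟩
  let k : A ≃[L] h.E Y :=
    { Embedding.ofInjective hinj with
      toEquiv := .ofBijective _ ⟨hinj, hs.2.evalOn_surjective (hs.1.1 A hA).2 hYc hYD⟩ }
  refine le_antisymm hYD ?_
  rintro _ ⟨φ, rfl⟩
  obtain ⟨y, hy⟩ := hs.1.evaluationSurjective (inIScP_of_isClosed Y hYc) (φ.comp k.symm.toHom)
  have hφ : ⇑φ = y := funext fun a =>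
    calc φ a = φ (k.symm (k a)) := by rw [k.symm_apply_apply]
      _ = y.1 a := hy (k a)
  exact hφ ▸ y.2

theorem injectiveIn_ISP [Finite M] (hs : h.YieldsStrongDuality) : InjectiveIn (ISP L M) M := by
  intro A B hA hB f φ
  have hsep (a b : A) (hab : ∀ y ∈ h.rangeD f.toHom, y a = y b) : a = b :=
    f.injective <| eq_of_forall_hom_eq hB fun ψ => hab _ (h.mem_rangeD_iff.2 ⟨ψ, rfl⟩)
  have hrange : h.rangeD f.toHom = h.D A :=
    hs.eq_D_of_separates hA (h.isClosed_rangeD f.toHom) (h.rangeD_le_D f.toHom) hsep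
  have hφ : ⇑φ ∈ h.rangeD f.toHom := hrange ▸ ⟨φ, rfl⟩
  obtain ⟨ψ, hψ⟩ := h.mem_rangeD_iff.1 hφ
  exact ⟨ψ, DFunLike.coe_injective hψ⟩

end YieldsStrongDuality

end TotalAlterEgo

end NaturalDuality

theorem lemma6p1 {L : FirstOrder.Language.{u₁, v₁}} [L.IsAlgebraic] {L' : FirstOrder.Language.{u₂, v₂}}
    {M : Type u} [Nonempty M] [Finite M] [L.Structure M] [L'.Structure M]
    [TopologicalSpace M] [DiscreteTopology M]
    (h : NaturalDuality.TotalAlterEgo L L' M) (hs : h.YieldsStrongDuality) :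
    Amalgamation (NaturalDuality.ISP L M) :=
  hs.injectiveIn_ISP.amalgamation
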